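/- Let $R$ be an associative ring with unit and $M$ a left $R$-module. Let $\sigma[M]$ be the full subcategory of left $R$-modules that are isomorphic to submodules of homomorphic images of direct sums of copies of $M$, and assume that $M$ is projective in $\sigma[M]$. For submodules $N,L\le M$ put $N_ML=\sum\{f(N)\mid f\in\mathrm{Hom}_R(M,L)\}\le M$. A submodule $N\le M$ is fully invariant if $f(N)\subseteq N$ for every endomorphism $f$ of $M$. A large prime submodule of $M$ is a submodule $P\neq M$ such that, for all fully invariant submodules $N,L$ of $M$, $N_ML\subseteq P$ implies $N\subseteq P$ or $L\subseteq P$. Let $LgSpec(M)$ be the set of large prime submodules of $M$, with the topology whose open sets are the sets $\mathcal U(N)=\{P\in LgSpec(M)\mid N\nsubseteq P\}$, $N$ a fully invariant submodule of $M$. A topological space $X$ is weakly scattered if every nonempty closed set $F\subseteq X$ contains a point $x$ that has an open neighbourhood $U$ with $U\cap F\subseteq\overline{\{x\}}$. 1. If for every fully invariant submodule $N\le M$ the factor module $M/N$ has finite uniform dimension (that is, contains no infinite direct sum of nonzero submodules), then $LgSpec(M)$ is weakly scattered. 2. If $M$ has Krull dimension (that is, the lattice of submodules of $M$ has a deviation,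 with arbitrary ordinals as values), then $LgSpec(M)$ is weakly scattered. -/

import Mathlib

universe u v

section Sigma

/-- `X` is `M`-generated: a homomorphic image of a direct sum of copies of `M`. -/
def IsGeneratedBy (R : Type u) [Ring R] (M : Type v) [AddCommGroup M] [Module R M]
    (X : Type v) [AddCommGroup X] [Module R X] : Prop :=
  ∃ (ι : Type v) (g : (ι →₀ M) →ₗ[R] X), Function.Surjective g

/-- `N` is an object of `σ[M]` (is subgenerated by `M`): `N` is isomorphic to a submodule of an
`M`-generated module. -/
def IsSubgeneratedBy (R : Type u) [Ring R] (M : Type v) [AddCommGroup M] [Module R M]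
    (N : Type v) [AddCommGroup N] [Module R N] : Prop :=
  ∃ (X : Type v) (_ : AddCommGroup X) (_ : Module R X) (j : N →ₗ[R] X),
    IsGeneratedBy R M X ∧ Function.Injective j

/-- `P` is projective in `σ[M]`: `P` lies in `σ[M]` and every homomorphism from `P` to an object
of `σ[M]` lifts along every epimorphism of `σ[M]`. -/
def IsProjectiveInSigma (R : Type u) [Ring R] (M : Type v) [AddCommGroup M] [Module R M]
    (P : Type v) [AddCommGroup P] [Module R P] : Prop :=
  IsSubgeneratedBy R M P ∧
    ∀ (A : Type v) [AddCommGroup A] [Module R A] (B : Type v) [AddCommGroup B] [Module R B],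
      IsSubgeneratedBy R M A → IsSubgeneratedBy R M B →
        ∀ (g : A →ₗ[R] B) (f : P →ₗ[R] B), Function.Surjective g →
          ∃ h : P →ₗ[R] A, g ∘ₗ h = f

end Sigma

section Dimension

/-- A module has finite uniform dimension if it contains no infinite direct sum of nonzero
submodules. -/
def HasFiniteUniformDimension (R : Type u) [Ring R] (M : Type v) [AddCommGroup M] [Module R M] :
    Prop :=
  ¬ ∃ A : ℕ → Submodule R M, (∀ i, A i ≠ ⊥) ∧ iSupIndep A

/-- The interval `[a, b]` of a partially ordered set has deviation at most `α`: there is no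
infinite descending chain `b = c 0 ≥ c 1 ≥ ⋯ ≥ a` none of whose factors `[c (i + 1), c i]` has
deviation less than `α` (a one-point interval has deviation `-1`). -/
def DeviationLE {A : Type v} [PartialOrder A] (α : Ordinal.{v}) (a b : A) : Prop :=
  ∀ c : ℕ → A, Antitone c → c 0 = b → (∀ i, a ≤ c i) →
    ∃ i, c (i + 1) = c i ∨ ∃ β, ∃ _ : β < α, DeviationLE β (c (i + 1)) (c i)
termination_by α

/-- A module has Krull dimension (in the sense of Gabriel and Rentschler, for arbitrary ordinals)
if its lattice of submodules has a deviation. The submodules of a factor `K / N` are the elements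
of the interval `[N, K]`. -/
def HasKrullDimension (R : Type u) [Ring R] (M : Type v) [AddCommGroup M] [Module R M] : Prop :=
  ∃ α : Ordinal.{v}, DeviationLE α (⊥ : Submodule R M) ⊤

end Dimension

section LargeSpectrum

variable {R : Type u} [Ring R] {M : Type v} [AddCommGroup M] [Module R M]

/-- The product `N_M L`, the sum of the images `f(N)` over all homomorphisms `f : M → L`,
as a submodule of `M`. -/
def submoduleProd (N L : Submodule R M) : Submodule R M :=
  ⨆ f : M →ₗ[R] L, N.map (L.subtype ∘ₗ f)

/-- `P` is a large prime submodule of `M`: a proper submodule that is prime relative to the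
fully invariant submodules. -/
def IsLargePrime (P : Submodule R M) : Prop :=
  P ≠ ⊤ ∧ ∀ N L : Submodule R M, N.IsFullyInvariant → L.IsFullyInvariant →
    submoduleProd N L ≤ P → N ≤ P ∨ L ≤ P

variable (R M) in
/-- The large spectrum of `M`. -/
def LgSpec : Type v := {P : Submodule R M // IsLargePrime P}

/-- The set `U(N)` of large primes not containing `N`. -/
def LgSpec.basicOpen (N : Submodule R M) : Set (LgSpec R M) := {P | ¬ N ≤ P.1}

theorem submoduleProd_le_inf {N L : Submodule R M} (hN : N.IsFullyInvariant) :
    submoduleProd N L ≤ N ⊓ L := by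
  refine iSup_le fun f => le_inf ?_ ?_
  · exact Submodule.map_le_iff_le_comap.2 (hN (L.subtype ∘ₗ f))
  · rintro _ ⟨x, -, rfl⟩
    exact (f x).2

theorem isFullyInvariant_submoduleProd (N : Submodule R M) {L : Submodule R M}
    (hL : L.IsFullyInvariant) : (submoduleProd N L).IsFullyInvariant := by
  intro g
  refine iSup_le fun f => ?_
  rintro _ ⟨x, hx, rfl⟩
  have hm : submoduleProd N L =
      ⨆ f : M →ₗ[R] L, N.map (L.subtype ∘ₗ f) := rfl
  rw [Submodule.mem_comap, hm]
  exact Submodule.mem_iSup_of_mem ((g.restrict fun y hy => hL g hy) ∘ₗ f) ⟨x, hx, rfl⟩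

theorem LgSpec.basicOpen_submoduleProd {N L : Submodule R M} (hN : N.IsFullyInvariant)
    (hL : L.IsFullyInvariant) :
    LgSpec.basicOpen (submoduleProd N L) = LgSpec.basicOpen N ∩ LgSpec.basicOpen L := by
  ext P
  constructor
  · intro h
    exact ⟨fun hP => h ((submoduleProd_le_inf hN).trans (inf_le_left.trans hP)),
      fun hP => h ((submoduleProd_le_inf hN).trans (inf_le_right.trans hP))⟩
  · rintro ⟨h₁, h₂⟩ h
    exact (P.2.2 N L hN hL h).elim h₁ h₂

/-- The topology of the large spectrum: the open sets are exactly the sets `U(N)` with `N` a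
fully invariant submodule of `M`. -/
instance LgSpec.instTopologicalSpace : TopologicalSpace (LgSpec R M) where
  IsOpen W := ∃ N : Submodule R M, N.IsFullyInvariant ∧ W = LgSpec.basicOpen N
  isOpen_univ := ⟨⊤, fun _ _ _ => trivial, by
    ext P
    simpa [LgSpec.basicOpen] using P.2.1⟩
  isOpen_inter := by
    rintro _ _ ⟨N, hN, rfl⟩ ⟨L, hL, rfl⟩
    exact ⟨submoduleProd N L, isFullyInvariant_submoduleProd N hL,
      (LgSpec.basicOpen_submoduleProd hN hL).symm⟩
  isOpen_sUnion := by
    intro S hS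
    refine ⟨sSup {N | N.IsFullyInvariant ∧ LgSpec.basicOpen N ∈ S}, ?_, ?_⟩
    · intro g
      exact sSup_le fun N hN => (hN.1 g).trans (Submodule.comap_mono (le_sSup hN))
    · ext P
      simp only [Set.mem_sUnion, LgSpec.basicOpen, Set.mem_ofPred_eq, sSup_le_iff, not_forall]
      constructor
      · rintro ⟨W, hW, hP⟩
        obtain ⟨N, hN, rfl⟩ := hS W hW
        exact ⟨N, ⟨hN, hW⟩, hP⟩
      · rintro ⟨N, ⟨-, hW⟩, hP⟩
        exact ⟨_, hW, hP⟩

end LargeSpectrum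

/-- A topological space is weakly scattered if every nonempty closed subset `F` has a weakly
isolated point: a point `x` of `F` with an open neighbourhood `U` such that `U ∩ F` is contained
in the closure of `{x}`. -/
def IsWeaklyScattered (X : Type v) [TopologicalSpace X] : Prop :=
  ∀ F : Set X, IsClosed F → F.Nonempty →
    ∃ x ∈ F, ∃ U : Set X, IsOpen U ∧ x ∈ U ∧ U ∩ F ⊆ closure {x}

/-! The large spectrum is quasi-sober, so it is weakly scattered once every nonempty closed `F` has
an irreducible nonempty relatively open piece. If some `F` has none, splitting open sets forever
gives fully invariant `A i` such that each `A i` escapes some point of `F`, while each point of `F`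
fails to contain at most one of them. Modulo `LgSpec.kernel F` the `A i` form an infinite direct
sum; and points `Q i` of `F` missing `A i` make a separated family, which excludes a deviation. -/

section Topology

/-- If no nonempty relatively open subset of `F` is irreducible, then there are infinitely many
open sets whose traces on `F` are nonempty and pairwise disjoint. -/
theorem exists_seq_isOpen_of_not_isIrreducible {X : Type*} [TopologicalSpace X] {F : Set X}
    (hF : F.Nonempty)
    (h : ∀ U : Set X, IsOpen U → (F ∩ U).Nonempty → ¬ IsIrreducible (F ∩ U)) :
    ∃ U : ℕ → Set X, (∀ i, IsOpen (U i)) ∧ (∀ i, (F ∩ U i).Nonempty) ∧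
      ∀ i j, i ≠ j → ∀ x ∈ F, x ∈ U i → x ∉ U j := by
  have step : ∀ U : {U : Set X // IsOpen U ∧ (F ∩ U).Nonempty},
      ∃ V W : {U : Set X // IsOpen U ∧ (F ∩ U).Nonempty},
        V.1 ⊆ U.1 ∧ W.1 ⊆ U.1 ∧ ∀ x ∈ F, x ∈ V.1 → x ∉ W.1 := by
    rintro ⟨U, hU, hne⟩
    have h₁ : ¬ IsPreirreducible (F ∩ U) := fun h' => h U hU hne ⟨hne, h'⟩
    simp only [IsPreirreducible, not_forall] at h₁
    obtain ⟨u, v, hu, hv, hnu, hnv, huv⟩ := h₁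
    refine ⟨⟨U ∩ u, hU.inter hu, by rwa [← Set.inter_assoc]⟩,
      ⟨U ∩ v, hU.inter hv, by rwa [← Set.inter_assoc]⟩, Set.inter_subset_left,
      Set.inter_subset_left, fun x hx h₁ h₂ => huv ⟨x, ⟨hx, h₁.1⟩, h₁.2, h₂.2⟩⟩
  choose V W hV hW hVW using step
  -- Each stage keeps the half `V` for the sequence and goes on splitting the half `W`.
  let B : ℕ → {U : Set X // IsOpen U ∧ (F ∩ U).Nonempty} :=
    Nat.rec ⟨Set.univ, isOpen_univ, by simpa using hF⟩ fun _ U => W U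
  have hB : Antitone fun n => (B n).1 := antitone_nat_of_succ_le fun n => hW (B n)
  have key : ∀ i j, i < j → ∀ x ∈ F, x ∈ (V (B i)).1 → x ∉ (V (B j)).1 :=
    fun i j hij x hx hi hj => hVW (B i) x hx hi (hB (Nat.succ_le_of_lt hij) (hV (B j) hj))
  refine ⟨fun n => (V (B n)).1, fun n => (V (B n)).2.1, fun n => (V (B n)).2.2, ?_⟩
  intro i j hij x hx hi hj
  rcases hij.lt_or_gt with h' | h'
  · exact key i j h' x hx hi hj
  · exact key j i h' x hx hj hi

/-- The generic point of the closure of `F ∩ U` is weakly isolated in `F`: it lies in every open set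
meeting that closure, in particular in `U`. -/
theorem isWeaklyScattered_of_exists_isIrreducible {X : Type v} [TopologicalSpace X] [QuasiSober X]
    (h : ∀ F : Set X, IsClosed F → F.Nonempty →
      ∃ U : Set X, IsOpen U ∧ IsIrreducible (F ∩ U)) :
    IsWeaklyScattered X := by
  intro F hF hne
  obtain ⟨U, hU, hirr⟩ := h F hF hne
  obtain ⟨x, hx⟩ := QuasiSober.sober hirr.closure isClosed_closure
  have hxF : x ∈ F := closure_minimal Set.inter_subset_left hF hx.mem
  have hxU : x ∈ U := by
    rw [hx.mem_open_set_iff hU]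
    obtain ⟨y, hy⟩ := hirr.nonempty
    exact ⟨y, subset_closure hy, hy.2⟩
  refine ⟨x, hxF, U, hU, hxU, ?_⟩
  rw [hx.def, Set.inter_comm]
  exact subset_closure

end Topology

section Deviation

/-- An interval `[a, b]` with infinitely many elements `A i ≤ b` that are separated from each other
by elements `Q i ≥ a` has no deviation. -/
theorem not_deviationLE_of_separated {L : Type v} [CompleteLattice L] (α : Ordinal.{v}) {a b : L}
    (hab : a ≤ b) (A Q : ℕ → L) (hA : ∀ i, A i ≤ b) (haQ : ∀ i, a ≤ Q i)
    (hAQ : ∀ i, ¬ A i ≤ Q i) (hne : ∀ i j, i ≠ j → A j ≤ Q i) : ¬ DeviationLE α a b := by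
  induction α using WellFoundedLT.induction generalizing a b A Q with
  | ind α ih =>
  intro h
  rw [DeviationLE] at h
  -- Filtering indices by 2-adic valuation leaves infinitely many `A j` for each factor of the
  -- chain. As `d 0` may lie strictly below `b`, `c` replaces it by `b`.
  let d : ℕ → L := fun n => a ⊔ ⨆ j, ⨆ _ : 2 ^ n ∣ j, A j
  let c : ℕ → L := fun n => if n = 0 then b else d n
  have hd : Antitone d := by
    intro m n hmn
    refine sup_le_sup_left (iSup_mono fun j => iSup_le fun hj => ?_) a
    exact le_iSup_of_le ((pow_dvd_pow 2 hmn).trans hj) le_rfl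
  have hdb : ∀ n, d n ≤ b := fun n => sup_le hab (iSup_le fun j => iSup_le fun _ => hA j)
  have hdc : ∀ n, d n ≤ c n := by
    intro n
    by_cases hn : n = 0
    · simpa [c, hn] using hdb 0
    · simp [c, hn]
  have hc : ∀ n, c (n + 1) = d (n + 1) := fun n => by simp [c]
  have hca : Antitone c := antitone_nat_of_succ_le fun n => by
    rw [hc]
    exact (hd n.le_succ).trans (hdc n)
  obtain ⟨n, hn⟩ := h c hca (by simp [c]) fun i => le_sup_left.trans (hdc i)
  have hdvd : ∀ k, ¬ 2 ^ (n + 1) ∣ 2 ^ n * (2 * k + 1) := by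
    intro k hk
    rw [pow_succ] at hk
    have := Nat.dvd_of_mul_dvd_mul_left (by positivity) hk
    omega
  have hAc : ∀ k, A (2 ^ n * (2 * k + 1)) ≤ c n := fun k =>
    le_trans (le_sup_of_le_right (le_iSup₂_of_le _ (dvd_mul_right _ _) le_rfl)) (hdc n)
  have hcQ : ∀ k, c (n + 1) ≤ Q (2 ^ n * (2 * k + 1)) := by
    intro k
    rw [hc]
    refine sup_le (haQ _) (iSup_le fun j => iSup_le fun hj => hne _ _ ?_)
    rintro rfl
    exact hdvd k hj
  -- The indices of valuation exactly `n` separate `[c (n + 1), c n]`: one of them shows that it is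
  -- not a point, all of them feed the induction.
  rcases hn with hn | ⟨β, hβ, hn⟩
  · exact hAQ _ ((hAc 0).trans (hn ▸ hcQ 0))
  · refine ih β hβ (hca n.le_succ) (fun k => A (2 ^ n * (2 * k + 1)))
      (fun k => Q (2 ^ n * (2 * k + 1))) hAc hcQ (fun k => hAQ _) (fun i j hij => hne _ _ ?_) hn
    intro h'
    have := Nat.eq_of_mul_eq_mul_left (by positivity) h'
    omega

end Deviation

section LargeSpectrum

variable {R : Type u} [Ring R] {M : Type v} [AddCommGroup M] [Module R M]

theorem Submodule.IsFullyInvariant.sSup' {S : Set (Submodule R M)}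
    (hS : ∀ N ∈ S, N.IsFullyInvariant) : (sSup S).IsFullyInvariant :=
  fun g => sSup_le fun N hN => (hS N hN g).trans (Submodule.comap_mono (le_sSup hN))

theorem Submodule.IsFullyInvariant.iSup' {ι : Sort*} {A : ι → Submodule R M}
    (hA : ∀ i, (A i).IsFullyInvariant) : (⨆ i, A i).IsFullyInvariant :=
  Submodule.IsFullyInvariant.sSup' (by rintro _ ⟨i, rfl⟩; exact hA i)

theorem Submodule.IsFullyInvariant.sup' {N L : Submodule R M} (hN : N.IsFullyInvariant)
    (hL : L.IsFullyInvariant) : (N ⊔ L).IsFullyInvariant :=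
  fun g => sup_le ((hN g).trans (Submodule.comap_mono le_sup_left))
    ((hL g).trans (Submodule.comap_mono le_sup_right))

theorem Submodule.IsFullyInvariant.inf' {N L : Submodule R M} (hN : N.IsFullyInvariant)
    (hL : L.IsFullyInvariant) : (N ⊓ L).IsFullyInvariant :=
  fun g => le_inf (inf_le_left.trans (hN g)) (inf_le_right.trans (hL g))

/-- The largest fully invariant submodule contained in all points of a set of large primes. -/
def LgSpec.kernel (S : Set (LgSpec R M)) : Submodule R M :=
  sSup {N | N.IsFullyInvariant ∧ ∀ Q ∈ S, N ≤ Q.1}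

theorem LgSpec.isFullyInvariant_kernel (S : Set (LgSpec R M)) :
    (LgSpec.kernel S).IsFullyInvariant :=
  Submodule.IsFullyInvariant.sSup' fun _ hN => hN.1

theorem LgSpec.kernel_le {S : Set (LgSpec R M)} {Q : LgSpec R M} (hQ : Q ∈ S) :
    LgSpec.kernel S ≤ Q.1 :=
  sSup_le fun _ hN => hN.2 Q hQ

theorem LgSpec.le_kernel {S : Set (LgSpec R M)} {N : Submodule R M} (hN : N.IsFullyInvariant)
    (h : ∀ Q ∈ S, N ≤ Q.1) : N ≤ LgSpec.kernel S :=
  le_sSup ⟨hN, h⟩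

theorem LgSpec.isOpen_basicOpen {N : Submodule R M} (hN : N.IsFullyInvariant) :
    IsOpen (LgSpec.basicOpen N) :=
  ⟨N, hN, rfl⟩

/-- If `N` and `L` both escape the kernel, their open sets meet `S`, hence by irreducibility share a
point of `S`, which contradicts primeness there. -/
theorem LgSpec.isLargePrime_kernel {S : Set (LgSpec R M)} (hS : IsIrreducible S) :
    IsLargePrime (LgSpec.kernel S) := by
  obtain ⟨Q, hQ⟩ := hS.nonempty
  refine ⟨fun h => Q.2.1 (top_le_iff.1 (h ▸ LgSpec.kernel_le hQ)), fun N L hN hL h => ?_⟩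
  by_contra! hc
  have meets : ∀ {K : Submodule R M}, K.IsFullyInvariant → ¬ K ≤ LgSpec.kernel S →
      (S ∩ LgSpec.basicOpen K).Nonempty := by
    intro K hK hn
    by_contra he
    exact hn (LgSpec.le_kernel hK fun P hP => by_contra fun hKP => he ⟨P, hP, hKP⟩)
  obtain ⟨P, hP, hPN, hPL⟩ := hS.2 _ _ (LgSpec.isOpen_basicOpen hN) (LgSpec.isOpen_basicOpen hL)
    (meets hN hc.1) (meets hL hc.2)
  exact (P.2.2 N L hN hL (h.trans (LgSpec.kernel_le hP))).elim hPN hPL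

instance LgSpec.instQuasiSober : QuasiSober (LgSpec R M) where
  sober := by
    intro S hS hcl
    let P₀ : LgSpec R M := ⟨LgSpec.kernel S, LgSpec.isLargePrime_kernel hS⟩
    refine ⟨P₀, ?_⟩
    refine Set.Subset.antisymm ?_ fun Q hQ => ?_
    · refine closure_minimal (Set.singleton_subset_iff.2 ?_) hcl
      obtain ⟨N, hN, hSN⟩ := hcl.isOpen_compl
      have hiff : ∀ P : LgSpec R M, P ∈ S ↔ N ≤ P.1 := fun P => by
        have : P ∈ Sᶜ ↔ ¬ N ≤ P.1 := by rw [hSN]; rfl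
        exact not_iff_not.1 this
      exact (hiff P₀).2 <| LgSpec.le_kernel hN fun P hP => (hiff P).1 hP
    · rw [mem_closure_iff]
      rintro _ ⟨N, hN, rfl⟩ hQN
      have hP₀ : P₀ ∈ LgSpec.basicOpen N :=
        fun h : N ≤ LgSpec.kernel S => hQN (h.trans (LgSpec.kernel_le hQ))
      exact ⟨P₀, hP₀, rfl⟩

/-- A closed set of large primes witnessing that the large spectrum is not weakly scattered carries
infinitely many fully invariant submodules with nonempty, pairwise disjoint open sets. -/
theorem LgSpec.exists_seq_of_not_isWeaklyScattered (h : ¬ IsWeaklyScattered (LgSpec R M)) :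
    ∃ (F : Set (LgSpec R M)) (A : ℕ → Submodule R M), (∀ i, (A i).IsFullyInvariant) ∧
      (∀ i, ∃ Q ∈ F, ¬ A i ≤ Q.1) ∧ ∀ i j, i ≠ j → ∀ Q ∈ F, ¬ A i ≤ Q.1 → A j ≤ Q.1 := by
  have h₁ := mt isWeaklyScattered_of_exists_isIrreducible h
  simp only [not_forall, not_exists, not_and] at h₁
  obtain ⟨F, -, hne, hF⟩ := h₁
  obtain ⟨U, hU, hUne, hdisj⟩ :=
    exists_seq_isOpen_of_not_isIrreducible hne fun U hU _ => hF U hU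
  choose A hA hUA using hU
  refine ⟨F, A, hA, fun i => ?_, fun i j hij Q hQ hi => ?_⟩
  · obtain ⟨Q, hQ, hQU⟩ := hUne i
    rw [hUA] at hQU
    exact ⟨Q, hQ, hQU⟩
  · have := hdisj i j hij Q hQ (by rw [hUA]; exact hi)
    rw [hUA] at this
    exact not_not.1 this

theorem LgSpec.isWeaklyScattered_of_hasFiniteUniformDimension
    (h : ∀ N : Submodule R M, N.IsFullyInvariant → HasFiniteUniformDimension R (M ⧸ N)) :
    IsWeaklyScattered (LgSpec R M) := by
  by_contra hn
  obtain ⟨F, A, hA, hne, hdisj⟩ := LgSpec.exists_seq_of_not_isWeaklyScattered hn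
  set N := LgSpec.kernel F
  have hN : N.IsFullyInvariant := LgSpec.isFullyInvariant_kernel F
  refine h N hN ⟨fun i => (A i).map N.mkQ, fun i hi => ?_, fun i => ?_⟩
  · obtain ⟨Q, hQ, hQA⟩ := hne i
    have hi' : A i ≤ LinearMap.ker N.mkQ := LinearMap.le_ker_iff_map.2 hi
    rw [Submodule.ker_mkQ] at hi'
    exact hQA (hi'.trans (LgSpec.kernel_le hQ))
  · have hB : (⨆ j, ⨆ _ : j ≠ i, A j).IsFullyInvariant :=
      Submodule.IsFullyInvariant.iSup' fun j => Submodule.IsFullyInvariant.iSup' fun _ => hA j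
    -- Each point of `F` contains `A i` or all the other `A j`, so it contains this fully invariant
    -- intersection.
    have key : (N ⊔ A i) ⊓ (N ⊔ ⨆ j, ⨆ _ : j ≠ i, A j) ≤ N := by
      refine LgSpec.le_kernel ((hN.sup' (hA i)).inf' (hN.sup' hB)) fun Q hQ => ?_
      have hNQ : N ≤ Q.1 := LgSpec.kernel_le hQ
      by_cases hi : A i ≤ Q.1
      · exact inf_le_left.trans (sup_le hNQ hi)
      · exact inf_le_right.trans
          (sup_le hNQ (iSup₂_le fun j hj => hdisj i j hj.symm Q hQ hi))
    simp only [← Submodule.map_iSup]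
    rw [disjoint_iff, ← (Submodule.comap_injective_of_surjective N.mkQ_surjective).eq_iff,
      Submodule.comap_inf, Submodule.comap_map_mkQ, Submodule.comap_map_mkQ,
      Submodule.comap_bot, Submodule.ker_mkQ]
    exact le_antisymm key (le_inf le_sup_left le_sup_left)

theorem LgSpec.isWeaklyScattered_of_hasKrullDimension (h : HasKrullDimension R M) :
    IsWeaklyScattered (LgSpec R M) := by
  by_contra hn
  obtain ⟨F, A, -, hne, hdisj⟩ := LgSpec.exists_seq_of_not_isWeaklyScattered hn
  choose Q hQ hAQ using hne
  obtain ⟨α, hα⟩ := h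
  exact not_deviationLE_of_separated α bot_le A (fun i => (Q i).1) (fun _ => le_top)
    (fun _ => bot_le) hAQ (fun i j hij => hdisj i j hij _ (hQ i) (hAQ i)) hα

end LargeSpectrum

theorem mainTheorem5 (R : Type u) [Ring R] (M : Type v) [AddCommGroup M] [Module R M]
    (hM : IsProjectiveInSigma R M M) :
    ((∀ N : Submodule R M, N.IsFullyInvariant → HasFiniteUniformDimension R (M ⧸ N)) →
        IsWeaklyScattered (LgSpec R M)) ∧
      (HasKrullDimension R M → IsWeaklyScattered (LgSpec R M)) :=
  ⟨LgSpec.isWeaklyScattered_of_hasFiniteUniformDimension,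
    LgSpec.isWeaklyScattered_of_hasKrullDimension⟩
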